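/- Let $d$ be a non-negative integer and let $\Lambda$ be a lattice in $\mathbb{R}^d$ (a discrete subgroup that spans $\mathbb{R}^d$ over $\mathbb{R}$). Let $OC(\Lambda)$ be the set of all linear isometries $R\in O(d)$ for which $\Lambda\cap R\Lambda$ has full rank $d$. Let $\Gamma_0$ be an orthogonal lattice, i.e. the $\mathbb{Z}$-span of an orthogonal (not necessarily orthonormal) basis of $\mathbb{R}^d$, and let $G=\{R\in O(d): R\Gamma_0=\Gamma_0\}$ be its symmetry group. If $G\subseteq OC(\Lambda)$, then $\Lambda$ has a well-rounded sublattice: there is a lattice $\Gamma\subseteq\Lambda$ in $\mathbb{R}^d$ whose non-zero vectors of minimal length span $\mathbb{R}^d$ over $\mathbb{R}$. -/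

import Mathlib

/-- The image `R Λ` of an additive subgroup `Λ` of `ℝ^d` under a linear isometry `R ∈ O(d)`. -/
noncomputable def latticeImage {d : ℕ}
    (R : EuclideanSpace ℝ (Fin d) ≃ₗᵢ[ℝ] EuclideanSpace ℝ (Fin d))
    (Λ : Submodule ℤ (EuclideanSpace ℝ (Fin d))) :
    Submodule ℤ (EuclideanSpace ℝ (Fin d)) :=
  Λ.map (R.toLinearEquiv.toLinearMap.restrictScalars ℤ)

/-- `OC(Λ)`: the linear isometries `R ∈ O(d)` for which `Λ ∩ R Λ` has full rank `d`,
that is, spans `ℝ^d` over `ℝ` (discreteness is inherited from `Λ`). -/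
def coincidenceIsometries {d : ℕ} (Λ : Submodule ℤ (EuclideanSpace ℝ (Fin d))) :
    Set (EuclideanSpace ℝ (Fin d) ≃ₗᵢ[ℝ] EuclideanSpace ℝ (Fin d)) :=
  {R | Submodule.span ℝ
    ((Λ ⊓ latticeImage R Λ : Submodule ℤ (EuclideanSpace ℝ (Fin d))) :
      Set (EuclideanSpace ℝ (Fin d))) = ⊤}

theorem latticeImage_one {d : ℕ} (Λ : Submodule ℤ (EuclideanSpace ℝ (Fin d))) :
    latticeImage 1 Λ = Λ := by
  ext x
  simp [latticeImage]

theorem latticeImage_mul {d : ℕ}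
    (R S : EuclideanSpace ℝ (Fin d) ≃ₗᵢ[ℝ] EuclideanSpace ℝ (Fin d))
    (Λ : Submodule ℤ (EuclideanSpace ℝ (Fin d))) :
    latticeImage (R * S) Λ = latticeImage R (latticeImage S Λ) := by
  ext x
  simp [latticeImage]

/-- The symmetry (point) group of `Γ`: the linear isometries `R ∈ O(d)` with `R Γ = Γ`. -/
noncomputable def latticeSymmetryGroup {d : ℕ} (Γ : Submodule ℤ (EuclideanSpace ℝ (Fin d))) :
    Subgroup (EuclideanSpace ℝ (Fin d) ≃ₗᵢ[ℝ] EuclideanSpace ℝ (Fin d)) where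
  carrier := {R | latticeImage R Γ = Γ}
  one_mem' := latticeImage_one Γ
  mul_mem' := by
    intro R S hR hS
    simp only [Set.mem_ofPred_eq] at hR hS ⊢
    rw [latticeImage_mul, hS, hR]
  inv_mem' := by
    intro R hR
    simp only [Set.mem_ofPred_eq] at hR ⊢
    conv_lhs => rw [← hR]
    rw [← latticeImage_mul, inv_mul_cancel, latticeImage_one]

/-- An orthogonal lattice: the `ℤ`-span of an orthogonal (not necessarily orthonormal) basis
of `ℝ^d`. -/
def IsOrthogonalLattice {d : ℕ} (Γ : Submodule ℤ (EuclideanSpace ℝ (Fin d))) : Prop :=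
  ∃ b : Module.Basis (Fin d) ℝ (EuclideanSpace ℝ (Fin d)),
    (∀ i j, i ≠ j → inner ℝ (b i) (b j) = 0) ∧ Γ = Submodule.span ℤ (Set.range b)

/-- The non-zero vectors of `Γ` of minimal length. -/
def minimalVectors {d : ℕ} (Γ : Submodule ℤ (EuclideanSpace ℝ (Fin d))) :
    Set (EuclideanSpace ℝ (Fin d)) :=
  {x | x ∈ Γ ∧ x ≠ 0 ∧ ∀ y ∈ Γ, y ≠ 0 → ‖x‖ ≤ ‖y‖}

/-- `Γ` is well-rounded: its non-zero vectors of minimal length span `ℝ^d` over `ℝ`. -/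
def IsWellRounded {d : ℕ} (Γ : Submodule ℤ (EuclideanSpace ℝ (Fin d))) : Prop :=
  Submodule.span ℝ (minimalVectors Γ) = ⊤

/-! The reflection `R` in `bᵢᗮ` maps `Γ₀` to itself, so `Λ ∩ R Λ` spans, and `x - R x ∈ Λ` is a
non-zero vector of the line `ℝ bᵢ` for some `x` in this intersection. Hence `Λ` contains an
orthogonal basis of `ℝ^d`, but it need not contain an orthogonal basis of vectors of equal length.
Instead one uses sign combinations `∑ i, ± uᵢ` of an orthogonal family `u` in `Λ`, all of which
have squared length `∑ i, ‖uᵢ‖²`. Integer multiples make the `‖uᵢ‖²` nearly proportional to any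
prescribed weights. It then suffices to find `d` sign vectors such that a non-zero integer
combination of them either has no zero coordinate, and is therefore at least as long as a sign
vector, or is longer by a definite factor in the weighted norm. Such sign vectors are built by
induction on `d = 2 ^ k + r` from a Hadamard matrix of order `2 ^ k` and a solution for
`r ≤ 2 ^ k`. -/

section SignMatrix

open Matrix

variable {m n o ι κ α : Type*}

theorem odd_vecMul_iff [Fintype m] {A : Matrix m n ℤ} (hA : ∀ i j, IsUnit (A i j)) (c : m → ℤ)
    (j : n) : Odd ((c ᵥ* A) j) ↔ Odd (c ⬝ᵥ c) := by
  have hdiff : Even ((c ᵥ* A) j - c ⬝ᵥ c) := by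
    simp only [vecMul, dotProduct, ← Finset.sum_sub_distrib, ← mul_sub]
    refine Finset.even_sum _ fun i _ => ?_
    rcases Int.isUnit_iff.mp (hA i j) with h | h <;> rw [h, Int.even_mul, Int.even_sub] <;>
      by_cases hc : Even (c i) <;> simp [hc]
  grind

theorem isUnit_apply_of_isHadamard [Fintype n] [DecidableEq n] {H : Matrix n n ℤ}
    (hH : H.IsHadamard) (i j : n) : IsUnit (H i j) :=
  Int.isUnit_iff.mpr (Unitary.mem_iff_eq_one_or_eq_neg_one.mp (hH.apply_mem i j))

theorem vecMul_dotProduct_vecMul_of_isHadamard [Fintype n] [DecidableEq n] {H : Matrix n n ℤ}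
    (hH : H.IsHadamard) (c : n → ℤ) :
    (c ᵥ* H) ⬝ᵥ (c ᵥ* H) = Fintype.card n * (c ⬝ᵥ c) := by
  rw [← mulVec_transpose H, dotProduct_mulVec, mulVec_transpose, vecMul_vecMul,
    ← conjTranspose_eq_transpose_of_trivial, hH.mul_conjTranspose, vecMul_smul, vecMul_one,
    smul_dotProduct, smul_eq_mul]

theorem exists_isHadamard_two_pow (k : ℕ) :
    ∃ H : Matrix (Fin (2 ^ k)) (Fin (2 ^ k)) ℤ, H.IsHadamard := by
  induction k with
  | zero => exact ⟨1, by constructor <;> simp [one_apply, Subsingleton.elim _ (0 : Fin 1)]⟩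
  | succ k ih =>
    obtain ⟨H, hH⟩ := ih
    have hS : (!![1, 1; 1, -1] : Matrix (Fin 2) (Fin 2) ℤ).IsHadamard := by
      constructor
      · simp [Fin.forall_fin_two, Unitary.mem_iff_eq_one_or_eq_neg_one]
      · ext i j
        fin_cases i <;> fin_cases j <;> simp [mul_apply]
      · ext i j
        fin_cases i <;> fin_cases j <;> simp [mul_apply]
    exact ⟨_, (hH.kronecker hS).reindex finProdFinEquiv finProdFinEquiv⟩

-- The minus sign keeps the matrix non-singular: when `p + q ᵥ* E` vanishes, twice a combination of
-- the rows of `E * X` remains.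
theorem vecMul_fromBlocks_mul_neg_mul {R : Type*} [Ring R] [Fintype m] [Fintype κ]
    (H : Matrix m n R) (X : Matrix m o R) (E : Matrix κ m R) (p : m → R) (q : κ → R) :
    Sum.elim p q ᵥ* fromBlocks H X (E * H) (-(E * X)) =
      Sum.elim ((p + q ᵥ* E) ᵥ* H) ((p + q ᵥ* E) ᵥ* X - 2 • (q ᵥ* (E * X))) := by
  simp only [vecMul_fromBlocks, Sum.elim_comp_inl, Sum.elim_comp_inr, add_vecMul, vecMul_vecMul,
    vecMul_neg]
  congr 1
  abel

theorem vecMul_fromBlocks_apply_ne_zero [Fintype n] [DecidableEq n] [Fintype κ]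
    {H : Matrix n n ℤ} (hH : H.IsHadamard) {X : Matrix n o ℤ} {E : Matrix κ n ℤ}
    (hX : ∀ a l, IsUnit (X a l)) (p : n → ℤ) (q : κ → ℤ)
    (hodd : Odd ((p + q ᵥ* E) ⬝ᵥ (p + q ᵥ* E))) (s : n ⊕ o) :
    (Sum.elim p q ᵥ* fromBlocks H X (E * H) (-(E * X))) s ≠ 0 := by
  rw [vecMul_fromBlocks_mul_neg_mul]
  rcases s with a | l
  · have hCH := (odd_vecMul_iff (isUnit_apply_of_isHadamard hH) (p + q ᵥ* E) a).mpr hodd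
    rw [Sum.elim_inl]
    grind
  · have hCX := (odd_vecMul_iff hX (p + q ᵥ* E) l).mpr hodd
    simp only [Sum.elim_inr, Pi.sub_apply, Pi.smul_apply]
    grind

theorem sum_elim_div_card [Fintype α] [Nonempty α] [Fintype κ] (t : ℝ) (w : κ → ℝ) :
    ∑ s, Sum.elim (fun _ : α => t / Fintype.card α) w s = t + ∑ k, w k := by
  simp only [Fintype.sum_sum_type, Sum.elim_inl, Sum.elim_inr, Finset.sum_const, Finset.card_univ,
    nsmul_eq_mul]
  rw [mul_div_cancel₀ _ (by simp)]

theorem sum_weight_mul_sq_vecMul_fromBlocks [Fintype α] [DecidableEq α] [Nonempty α] [Fintype κ]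
    {H : Matrix α α ℤ} (hH : H.IsHadamard) (X : Matrix α κ ℤ) (E : Matrix κ α ℤ) (t : ℝ)
    (w : κ → ℝ) (p : α → ℤ) (q : κ → ℤ) :
    ∑ s, Sum.elim (fun _ => t / Fintype.card α) w s *
        ((Sum.elim p q ᵥ* fromBlocks H X (E * H) (-(E * X))) s : ℝ) ^ 2 =
      t * ((p + q ᵥ* E) ⬝ᵥ (p + q ᵥ* E) : ℤ) +
        ∑ l, w l * (((p + q ᵥ* E) ᵥ* X) l - 2 * (q ᵥ* (E * X)) l : ℝ) ^ 2 := by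
  have hparseval : ∑ a, (((p + q ᵥ* E) ᵥ* H) a : ℝ) ^ 2 =
      Fintype.card α * ((p + q ᵥ* E) ⬝ᵥ (p + q ᵥ* E) : ℤ) := by
    have h := vecMul_dotProduct_vecMul_of_isHadamard hH (p + q ᵥ* E)
    simp only [dotProduct, ← sq] at h ⊢
    exact_mod_cast h
  simp only [vecMul_fromBlocks_mul_neg_mul, Fintype.sum_sum_type, Sum.elim_inl, Sum.elim_inr,
    ← Finset.mul_sum, hparseval]
  rw [← mul_assoc, div_mul_cancel₀ _ (by simp)]
  simp

/-- A square sign matrix `A` with positive column weights `w` is round if a non-zero integer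
combination of its rows can have a zero coordinate only when its weighted square norm is at least
`4 / 3` times that of the rows, which is `∑ i, w i`. The gap makes the rows shortest vectors of the
lattice they generate for all weights close to `w`. -/
structure IsRoundSignMatrix [Fintype ι] (A : Matrix ι ι ℤ) (w : ι → ℝ) : Prop where
  isUnit_apply : ∀ i j, IsUnit (A i j)
  weight_pos : ∀ i, 0 < w i
  forall_ne_zero_or_le : ∀ c ≠ 0, (∀ i, (c ᵥ* A) i ≠ 0) ∨
    4 / 3 * ∑ i, w i ≤ ∑ i, w i * ((c ᵥ* A) i : ℝ) ^ 2

namespace IsRoundSignMatrix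

variable [Fintype ι] [Fintype κ] [Fintype α]

theorem of_subsingleton [Subsingleton ι] :
    IsRoundSignMatrix (fun _ _ => 1 : Matrix ι ι ℤ) (fun _ => 1) where
  isUnit_apply _ _ := isUnit_one
  weight_pos _ := one_pos
  forall_ne_zero_or_le c hc := by
    obtain ⟨i, hi⟩ := Function.ne_iff.mp hc
    refine Or.inl fun j => ?_
    simpa [vecMul, dotProduct, Fintype.sum_subsingleton _ i] using hi

theorem reindex {A : Matrix ι ι ℤ} {w : ι → ℝ} (h : IsRoundSignMatrix A w) (e : ι ≃ κ) :
    IsRoundSignMatrix (Matrix.reindex e e A) (w ∘ e.symm) where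
  isUnit_apply _ _ := h.isUnit_apply _ _
  weight_pos _ := h.weight_pos _
  forall_ne_zero_or_le c hc := by
    have hvec : c ᵥ* Matrix.reindex e e A = ((c ∘ e) ᵥ* A) ∘ e.symm :=
      submatrix_vecMul_equiv A c e.symm e.symm
    have hce : c ∘ e ≠ 0 := by simpa [funext_iff, e.forall_congr_left] using hc
    simp only [hvec, Function.comp_apply]
    rw [e.symm.sum_comp w, e.symm.sum_comp fun i => w i * (((c ∘ e) ᵥ* A) i : ℝ) ^ 2]
    exact (h.forall_ne_zero_or_le _ hce).imp_left fun hne i => hne (e.symm i)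

theorem sum_weight_le {A : Matrix ι ι ℤ} {w : ι → ℝ} (h : IsRoundSignMatrix A w) {c : ι → ℤ}
    (hc : c ≠ 0) : ∑ i, w i ≤ ∑ i, w i * ((c ᵥ* A) i : ℝ) ^ 2 := by
  rcases h.forall_ne_zero_or_le c hc with hne | hle
  · refine Finset.sum_le_sum fun i _ => le_mul_of_one_le_right (h.weight_pos i).le ?_
    exact_mod_cast (one_le_sq_iff_one_le_abs _).mpr (Int.one_le_abs (hne i))
  · have hw : 0 ≤ ∑ i, w i := Finset.sum_nonneg fun i _ => (h.weight_pos i).le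
    linarith

theorem fromBlocks_of_isHadamard [DecidableEq α] [Nonempty α] [Nonempty κ] {H : Matrix α α ℤ}
    (hH : H.IsHadamard) {X : Matrix α κ ℤ} {E : Matrix κ α ℤ} (hX : ∀ a l, IsUnit (X a l))
    (hEH : ∀ k b, IsUnit ((E * H) k b)) {w : κ → ℝ} (h : IsRoundSignMatrix (E * X) w) :
    IsRoundSignMatrix (fromBlocks H X (E * H) (-(E * X)))
      (Sum.elim (fun _ => 2 * (∑ k, w k) / Fintype.card α) w) where
  isUnit_apply := by
    rintro (a | k) (b | l)
    exacts [isUnit_apply_of_isHadamard hH a b, hX a l, hEH k b, (h.isUnit_apply k l).neg]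
  weight_pos := by
    have hpos : 0 < ∑ k, w k := Finset.sum_pos (fun k _ => h.weight_pos k) Finset.univ_nonempty
    rintro (a | k)
    · simp only [Sum.elim_inl]
      positivity
    · exact h.weight_pos k
  forall_ne_zero_or_le x hx := by
    obtain ⟨p, q, rfl⟩ : ∃ p q, x = Sum.elim p q := ⟨_, _, (Sum.elim_comp_inl_inr x).symm⟩
    rw [sum_elim_div_card, sum_weight_mul_sq_vecMul_fromBlocks hH]
    set C := p + q ᵥ* E with hC
    set W := ∑ k, w k
    have hnonneg : 0 ≤ C ⬝ᵥ C := Finset.sum_nonneg fun a _ => mul_self_nonneg (C a)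
    -- The total weight is `3 * W`, and the Hadamard coordinates alone have weighted square norm
    -- `2 * W * (C ⬝ᵥ C)`, at least `4 * W` if `2 ≤ C ⬝ᵥ C`: the source of the factor `4 / 3`.
    obtain hzero | hone | htwo : C ⬝ᵥ C = 0 ∨ C ⬝ᵥ C = 1 ∨ 2 ≤ C ⬝ᵥ C := by omega
    · right
      have hC0 : C = 0 := dotProduct_self_eq_zero.mp hzero
      have hq : q ≠ 0 := by
        rintro rfl
        have hp : p = 0 := by simpa [hC] using hC0
        exact hx (by simp [hp])
      calc 4 / 3 * (2 * W + W) = 4 * W := by ring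
        _ ≤ 4 * ∑ l, w l * ((q ᵥ* (E * X)) l : ℝ) ^ 2 := by gcongr; exact h.sum_weight_le hq
        _ = _ := by
          simp only [hC0, Finset.mul_sum, zero_vecMul, dotProduct_zero, Pi.zero_apply,
            Int.cast_zero, mul_zero, zero_add]
          exact Finset.sum_congr rfl fun l _ => by ring
    · exact .inl (vecMul_fromBlocks_apply_ne_zero hH hX p q (by rw [← hC, hone]; exact odd_one))
    · right
      have hW : 0 ≤ W := Finset.sum_nonneg fun k _ => (h.weight_pos k).le
      calc 4 / 3 * (2 * W + W) = 2 * W * (2 : ℤ) := by push_cast; ring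
        _ ≤ 2 * W * (C ⬝ᵥ C : ℤ) := by gcongr
        _ ≤ _ := le_add_of_nonneg_right <| Finset.sum_nonneg fun l _ =>
          mul_nonneg (h.weight_pos l).le (sq_nonneg _)

end IsRoundSignMatrix

-- The first `2 ^ k` columns form a Hadamard block and the remaining `r ≤ 2 ^ k` a smaller round
-- matrix; `E` selects `r` rows of the Hadamard block.
theorem exists_isRoundSignMatrix (d : ℕ) :
    ∃ (A : Matrix (Fin d) (Fin d) ℤ) (w : Fin d → ℝ), IsRoundSignMatrix A w := by
  induction d using Nat.strong_induction_on with
  | _ d ih =>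
    obtain hd | hd := le_or_gt d 1
    · have : Subsingleton (Fin d) := Fin.subsingleton_iff_le_one.mpr hd
      exact ⟨_, _, .of_subsingleton⟩
    obtain ⟨k, r, hr, hrk, rfl⟩ : ∃ k r, 0 < r ∧ r ≤ 2 ^ k ∧ 2 ^ k + r = d := by
      have hlow := Nat.pow_log_le_self 2 (x := d - 1) (by omega)
      have hupp := Nat.lt_pow_succ_log_self one_lt_two (d - 1)
      exact ⟨Nat.log 2 (d - 1), d - 2 ^ Nat.log 2 (d - 1), by omega, by omega, by omega⟩
    have : NeZero r := ⟨hr.ne'⟩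
    obtain ⟨H, hH⟩ := exists_isHadamard_two_pow k
    obtain ⟨A, w, hA⟩ := ih r (by have := Nat.two_pow_pos k; omega)
    have hemb : Function.LeftInverse (Function.invFun (Fin.castLE hrk)) (Fin.castLE hrk) :=
      Function.leftInverse_invFun (Fin.castLE_injective hrk)
    let E : Matrix (Fin r) (Fin (2 ^ k)) ℤ := submatrix 1 (Fin.castLE hrk) id
    let X : Matrix (Fin (2 ^ k)) (Fin r) ℤ := A.submatrix (Function.invFun (Fin.castLE hrk)) id
    have hmul {s : ℕ} (M : Matrix (Fin (2 ^ k)) (Fin s) ℤ) :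
        E * M = M.submatrix (Fin.castLE hrk) id :=
      one_submatrix_mul (Fin.castLE hrk) (Equiv.refl _) M
    have hEX : E * X = A := by
      rw [hmul, submatrix_submatrix, hemb.comp_eq_id, Function.comp_id, submatrix_id_id]
    have hEH (i j) : IsUnit ((E * H) i j) := by
      rw [hmul]
      exact isUnit_apply_of_isHadamard hH _ _
    have hround := IsRoundSignMatrix.fromBlocks_of_isHadamard hH (X := X)
      (fun _ _ => hA.isUnit_apply _ _) hEH (hEX.symm ▸ hA)
    exact ⟨_, _, hround.reindex finSumFinEquiv⟩

end SignMatrix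

section Approximation

open Filter Topology

theorem exists_natCast_mul_sq_mem_Icc {ι : Type*} [Finite ι] {c w : ι → ℝ} (hc : ∀ i, 0 < c i)
    (hw : ∀ i, 0 < w i) {r : ℝ} (hr : 1 < r) :
    ∃ (a : ι → ℕ) (M : ℝ), 0 < M ∧ ∀ i, (a i * c i) ^ 2 ∈ Set.Icc (M * w i) (r * (M * w i)) := by
  have hclose (i : ι) : ∀ᶠ x : ℝ in atTop, (⌈√(w i) / c i * x⌉₊ / x * c i) ^ 2 < r * w i := by
    have hlim : Tendsto (fun x : ℝ => (⌈√(w i) / c i * x⌉₊ / x * c i) ^ 2) atTop (𝓝 (w i)) := by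
      have h := ((tendsto_nat_ceil_mul_div_atTop (R := ℝ)
        (div_nonneg (Real.sqrt_nonneg (w i)) (hc i).le)).mul_const (c i)).pow 2
      rwa [div_mul_cancel₀ _ (hc i).ne', Real.sq_sqrt (hw i).le] at h
    exact hlim.eventually_lt_const (lt_mul_of_one_lt_left (hw i) hr)
  obtain ⟨x, hx, hx0⟩ := ((eventually_all.mpr hclose).and (eventually_gt_atTop 0)).exists
  refine ⟨fun i => ⌈√(w i) / c i * x⌉₊, x ^ 2, by positivity, fun i => ⟨?_, ?_⟩⟩
  · have hceil : √(w i) * x ≤ ⌈√(w i) / c i * x⌉₊ * c i := by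
      rw [← div_le_iff₀ (hc i), ← div_mul_eq_mul_div]
      exact Nat.le_ceil _
    calc x ^ 2 * w i = (√(w i) * x) ^ 2 := by rw [mul_pow, Real.sq_sqrt (hw i).le, mul_comm]
      _ ≤ _ := by gcongr
  · calc (⌈√(w i) / c i * x⌉₊ * c i) ^ 2 = x ^ 2 * (⌈√(w i) / c i * x⌉₊ / x * c i) ^ 2 := by
          field_simp
      _ ≤ x ^ 2 * (r * w i) := by gcongr; exact (hx i).le
      _ = r * (x ^ 2 * w i) := by ring

end Approximation

section OrthogonalFamily

open Matrix

variable {ι E : Type*} [Fintype ι] [NormedAddCommGroup E] [InnerProductSpace ℝ E]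

theorem sum_smul_sum_smul_eq_sum_vecMul_smul {κ R G : Type*} [Fintype κ] [Semiring R]
    [AddCommMonoid G] [Module R G] (A : Matrix κ ι R) (c : κ → R) (u : ι → G) :
    ∑ j, c j • ∑ i, A j i • u i = ∑ i, (c ᵥ* A) i • u i := by
  simp only [vecMul, dotProduct, Finset.smul_sum, Finset.sum_smul, smul_smul]
  exact Finset.sum_comm

theorem norm_sq_sum_zsmul_of_pairwise_inner_eq_zero {u : ι → E}
    (hu : Pairwise fun i j => inner ℝ (u i) (u j) = 0) (c : ι → ℤ) :
    ‖∑ i, c i • u i‖ ^ 2 = ∑ i, ‖u i‖ ^ 2 * (c i : ℝ) ^ 2 := by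
  simp only [← Int.cast_smul_eq_zsmul ℝ]
  rw [← real_inner_self_eq_norm_sq, sum_inner]
  refine Finset.sum_congr rfl fun i _ => ?_
  rw [inner_sum, Finset.sum_eq_single_of_mem i (Finset.mem_univ i)]
  · rw [real_inner_smul_left, real_inner_smul_right, real_inner_self_eq_norm_sq]
    ring
  · intro j _ hji
    rw [real_inner_smul_left, real_inner_smul_right, hu hji.symm, mul_zero, mul_zero]

theorem IsRoundSignMatrix.norm_sum_row_smul_le {A : Matrix ι ι ℤ} {w : ι → ℝ}
    (h : IsRoundSignMatrix A w) {u : ι → E} (hu : Pairwise fun i j => inner ℝ (u i) (u j) = 0)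
    {M : ℝ} (hM : 0 ≤ M) (hMu : ∀ i, ‖u i‖ ^ 2 ∈ Set.Icc (M * w i) (4 / 3 * (M * w i)))
    {c : ι → ℤ} (hc : c ≠ 0) (j : ι) :
    ‖∑ i, A j i • u i‖ ≤ ‖∑ i, (c ᵥ* A) i • u i‖ := by
  have hrow : ‖∑ i, A j i • u i‖ ^ 2 = ∑ i, ‖u i‖ ^ 2 := by
    rw [norm_sq_sum_zsmul_of_pairwise_inner_eq_zero hu]
    refine Finset.sum_congr rfl fun i _ => ?_
    rw [← Int.cast_pow, Int.isUnit_sq (h.isUnit_apply j i), Int.cast_one, mul_one]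
  rw [← sq_le_sq₀ (norm_nonneg _) (norm_nonneg _), hrow,
    norm_sq_sum_zsmul_of_pairwise_inner_eq_zero hu]
  rcases h.forall_ne_zero_or_le c hc with hne | hle
  · refine Finset.sum_le_sum fun i _ => le_mul_of_one_le_right (sq_nonneg _) ?_
    exact_mod_cast (one_le_sq_iff_one_le_abs _).mpr (Int.one_le_abs (hne i))
  · calc ∑ i, ‖u i‖ ^ 2 ≤ ∑ i, 4 / 3 * (M * w i) := Finset.sum_le_sum fun i _ => (hMu i).2
      _ = M * (4 / 3 * ∑ i, w i) := by simp only [← Finset.mul_sum, mul_left_comm]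
      _ ≤ M * ∑ i, w i * ((c ᵥ* A) i : ℝ) ^ 2 := by gcongr
      _ = ∑ i, M * w i * ((c ᵥ* A) i : ℝ) ^ 2 := by simp only [Finset.mul_sum, mul_assoc]
      _ ≤ ∑ i, ‖u i‖ ^ 2 * ((c ᵥ* A) i : ℝ) ^ 2 := by
        gcongr with i
        exact (hMu i).1

end OrthogonalFamily

section SpanInt

open Module

variable {ι E : Type*} [NormedAddCommGroup E] [NormedSpace ℝ E] [FiniteDimensional ℝ E]

theorem discreteTopology_span_int_of_linearIndependent {u : ι → E} (hu : LinearIndependent ℝ u) :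
    DiscreteTopology (Submodule.span ℤ (Set.range u)) := by
  let b := Basis.extend hu.linearIndepOn_id
  have : Finite _ := Module.Finite.finite_basis b
  have hub : Set.range u ⊆ Set.range b := by
    rw [Basis.range_extend]
    exact hu.linearIndepOn_id.subset_extend _
  exact DiscreteTopology.of_subset (s := (Submodule.span ℤ (Set.range b) : Set E))
    (inferInstanceAs (DiscreteTopology (Submodule.span ℤ (Set.range b)))) (Submodule.span_mono hub)

theorem span_range_eq_top_of_linearIndependent_int [Fintype ι] {g : ι → E}
    [hdisc : DiscreteTopology (Submodule.span ℤ (Set.range g))] (hg : LinearIndependent ℤ g)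
    (hcard : Fintype.card ι = finrank ℝ E) : Submodule.span ℝ (Set.range g) = ⊤ := by
  apply Submodule.eq_top_of_finrank_eq
  rw [← hcard, ← finrank_span_eq_card hg]
  exact Real.finrank_eq_int_finrank_of_discrete hdisc

end SpanInt

section WellRounded

variable {d : ℕ}

theorem isZLattice_and_isWellRounded_of_norm_le {g : Fin d → EuclideanSpace ℝ (Fin d)}
    [DiscreteTopology (Submodule.span ℤ (Set.range g))] (hg0 : ∀ j, g j ≠ 0)
    (hmin : ∀ c : Fin d → ℤ, c ≠ 0 → ∀ j, ‖g j‖ ≤ ‖∑ i, c i • g i‖) :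
    IsZLattice ℝ (Submodule.span ℤ (Set.range g)) ∧
      IsWellRounded (Submodule.span ℤ (Set.range g)) := by
  have hind : LinearIndependent ℤ g := by
    refine Fintype.linearIndependent_iff.mpr fun c hc j => ?_
    by_contra hcj
    have hle := hmin c (fun h => hcj (congrFun h j)) j
    rw [hc, norm_zero, norm_le_zero_iff] at hle
    exact hg0 j hle
  have hspan : Submodule.span ℝ (Set.range g) = ⊤ :=
    span_range_eq_top_of_linearIndependent_int hind (by simp)
  refine ⟨⟨?_⟩, ?_⟩
  · exact top_unique (hspan.symm.trans_le (Submodule.span_mono Submodule.subset_span))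
  · refine top_unique (hspan.symm.trans_le (Submodule.span_mono ?_))
    rintro _ ⟨j, rfl⟩
    refine ⟨Submodule.subset_span ⟨j, rfl⟩, hg0 j, fun y hy hy0 => ?_⟩
    obtain ⟨c, rfl⟩ := (Submodule.mem_span_range_iff_exists_fun ℤ).mp hy
    exact hmin c (by rintro rfl; simp at hy0) j

theorem exists_isWellRounded_le_of_pairwise_inner_eq_zero
    {Λ : Submodule ℤ (EuclideanSpace ℝ (Fin d))} {v : Fin d → EuclideanSpace ℝ (Fin d)}
    (hvΛ : ∀ i, v i ∈ Λ) (hv0 : ∀ i, v i ≠ 0)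
    (hv : Pairwise fun i j => inner ℝ (v i) (v j) = 0) :
    ∃ Γ : Submodule ℤ (EuclideanSpace ℝ (Fin d)),
      Γ ≤ Λ ∧ (∃ _ : DiscreteTopology Γ, IsZLattice ℝ Γ) ∧ IsWellRounded Γ := by
  obtain ⟨A, w, hA⟩ := exists_isRoundSignMatrix d
  obtain ⟨a, M, hM, haM⟩ := exists_natCast_mul_sq_mem_Icc (fun i => norm_pos_iff.mpr (hv0 i))
    hA.weight_pos (show (1 : ℝ) < 4 / 3 by norm_num)
  let u i := a i • v i
  let g j := ∑ i, A j i • u i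
  have hMu i : ‖u i‖ ^ 2 ∈ Set.Icc (M * w i) (4 / 3 * (M * w i)) := by
    simpa [u, ← Nat.cast_smul_eq_nsmul ℝ, norm_smul] using haM i
  have hu0 i : u i ≠ 0 := fun h => by
    have hle := (hMu i).1
    rw [h, norm_zero, zero_pow two_ne_zero] at hle
    exact hle.not_gt (mul_pos hM (hA.weight_pos i))
  have hu : Pairwise fun i j => inner ℝ (u i) (u j) = 0 := fun i j hij => by
    simp [u, ← Nat.cast_smul_eq_nsmul ℝ, real_inner_smul_left, real_inner_smul_right, hv hij]
  have hgu : Submodule.span ℤ (Set.range g) ≤ Submodule.span ℤ (Set.range u) :=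
    Submodule.span_le.mpr <| Set.range_subset_iff.mpr fun j =>
      sum_mem fun i _ => Submodule.smul_mem _ _ (Submodule.subset_span ⟨i, rfl⟩)
  have huΛ : Submodule.span ℤ (Set.range u) ≤ Λ :=
    Submodule.span_le.mpr <| Set.range_subset_iff.mpr fun i => nsmul_mem (hvΛ i) _
  have hind : LinearIndependent ℝ u := linearIndependent_of_ne_zero_of_inner_eq_zero hu0 hu
  have hdisc : DiscreteTopology (Submodule.span ℤ (Set.range g)) :=
    DiscreteTopology.of_subset (discreteTopology_span_int_of_linearIndependent hind) hgu
  have hmin (c : Fin d → ℤ) (hc : c ≠ 0) (j) : ‖g j‖ ≤ ‖∑ i, c i • g i‖ := by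
    rw [sum_smul_sum_smul_eq_sum_vecMul_smul]
    exact hA.norm_sum_row_smul_le hu hM.le hMu hc j
  have hg0 j : g j ≠ 0 := fun h =>
    (hA.isUnit_apply j j).ne_zero
      (Fintype.linearIndependent_iff.mp (hind.restrict_scalars' ℤ) (A j) h j)
  obtain ⟨hlattice, hround⟩ := isZLattice_and_isWellRounded_of_norm_le hg0 hmin
  exact ⟨_, hgu.trans huΛ, ⟨hdisc, hlattice⟩, hround⟩

end WellRounded

section Coincidence

variable {d : ℕ} {Λ : Submodule ℤ (EuclideanSpace ℝ (Fin d))}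

theorem exists_mem_ne_zero_of_reflection_mem_coincidenceIsometries
    {K : Submodule ℝ (EuclideanSpace ℝ (Fin d))} (hK : K ≠ ⊥)
    (h : Kᗮ.reflection ∈ coincidenceIsometries Λ) : ∃ v ∈ Λ, v ∈ K ∧ v ≠ 0 := by
  by_contra! hzero
  have hle : Submodule.span ℝ
      ((Λ ⊓ latticeImage Kᗮ.reflection Λ : Submodule ℤ _) : Set _) ≤ Kᗮ := by
    refine Submodule.span_le.mpr ?_
    rintro x ⟨hx, y, hy, hyx⟩
    have hRx : Kᗮ.reflection x = y := hyx ▸ Submodule.reflection_reflection _ y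
    have hxK : x - Kᗮ.reflection x ∈ K := by
      rw [Submodule.reflection_orthogonal_apply, Submodule.reflection_apply, sub_neg_eq_add,
        add_sub_cancel]
      exact nsmul_mem (K.starProjection_apply_mem x) 2
    exact (Submodule.reflection_eq_self_iff x).mp
      (sub_eq_zero.mp (hzero _ (sub_mem hx (hRx ▸ hy)) hxK)).symm
  rw [show Submodule.span ℝ _ = ⊤ from h, top_le_iff, Submodule.orthogonal_eq_top_iff] at hle
  exact hK hle

theorem mem_latticeSymmetryGroup_of_involutive
    {R : EuclideanSpace ℝ (Fin d) ≃ₗᵢ[ℝ] EuclideanSpace ℝ (Fin d)} (hR : Function.Involutive R)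
    (hle : latticeImage R Λ ≤ Λ) : R ∈ latticeSymmetryGroup Λ := by
  have hge : latticeImage R (latticeImage R Λ) ≤ latticeImage R Λ := Submodule.map_mono hle
  rw [← latticeImage_mul, show R * R = 1 from LinearIsometryEquiv.ext hR, latticeImage_one] at hge
  exact hle.antisymm hge

theorem reflection_mem_latticeSymmetryGroup {ι : Type*} {b : ι → EuclideanSpace ℝ (Fin d)}
    (hb : Pairwise fun i j => inner ℝ (b i) (b j) = 0) (i : ι) :
    (ℝ ∙ b i)ᗮ.reflection ∈ latticeSymmetryGroup (Submodule.span ℤ (Set.range b)) := by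
  refine mem_latticeSymmetryGroup_of_involutive (Submodule.reflection_involutive _) ?_
  rw [latticeImage, Submodule.map_span, Submodule.span_le]
  rintro _ ⟨_, ⟨j, rfl⟩, rfl⟩
  have hj : b j ∈ Submodule.span ℤ (Set.range b) := Submodule.subset_span ⟨j, rfl⟩
  suffices (ℝ ∙ b i)ᗮ.reflection (b j) ∈ Submodule.span ℤ (Set.range b) from this
  obtain rfl | hij := eq_or_ne i j
  · rw [Submodule.reflection_orthogonalComplement_singleton_eq_neg]
    exact neg_mem hj
  · rwa [Submodule.reflection_mem_subspace_eq_self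
      (Submodule.mem_orthogonal_singleton_iff_inner_right.mpr (hb hij))]

theorem theorem2_general {b : Fin d → EuclideanSpace ℝ (Fin d)} (hb0 : ∀ i, b i ≠ 0)
    (hb : Pairwise fun i j => inner ℝ (b i) (b j) = 0)
    (hΛ : ∀ i, (ℝ ∙ b i)ᗮ.reflection ∈ coincidenceIsometries Λ) :
    ∃ Γ : Submodule ℤ (EuclideanSpace ℝ (Fin d)),
      Γ ≤ Λ ∧ (∃ _ : DiscreteTopology Γ, IsZLattice ℝ Γ) ∧ IsWellRounded Γ := by
  choose v hvΛ hvb hv0 using fun i =>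
    exists_mem_ne_zero_of_reflection_mem_coincidenceIsometries
      (mt Submodule.span_singleton_eq_bot.mp (hb0 i)) (hΛ i)
  refine exists_isWellRounded_le_of_pairwise_inner_eq_zero hvΛ hv0 fun i j hij => ?_
  obtain ⟨r, hr⟩ := Submodule.mem_span_singleton.mp (hvb i)
  obtain ⟨s, hs⟩ := Submodule.mem_span_singleton.mp (hvb j)
  rw [← hr, ← hs, real_inner_smul_left, real_inner_smul_right, hb hij, mul_zero, mul_zero]

end Coincidence

theorem theorem2 (d : ℕ)
    (Λ : Submodule ℤ (EuclideanSpace ℝ (Fin d))) [DiscreteTopology Λ] [IsZLattice ℝ Λ]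
    (Γ₀ : Submodule ℤ (EuclideanSpace ℝ (Fin d))) (hΓ₀ : IsOrthogonalLattice Γ₀)
    (hG : (latticeSymmetryGroup Γ₀ :
        Set (EuclideanSpace ℝ (Fin d) ≃ₗᵢ[ℝ] EuclideanSpace ℝ (Fin d))) ⊆
      coincidenceIsometries Λ) :
    ∃ Γ : Submodule ℤ (EuclideanSpace ℝ (Fin d)),
      Γ ≤ Λ ∧ (∃ _ : DiscreteTopology Γ, IsZLattice ℝ Γ) ∧ IsWellRounded Γ := by
  obtain ⟨b, hb, rfl⟩ := hΓ₀
  exact theorem2_general b.ne_zero hb fun i => hG (reflection_mem_latticeSymmetryGroup hb i)
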